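/- Let $K$ be a field, $X$ a non-empty set, and $\mathbb{A}_K(X)$ the free associative (unital) $K$-algebra with basis $X$, regarded as a ring. Definitions. An equation over an algebraic structure $\mathcal{M}$ is an equality of two terms in the language of $\mathcal{M}$ with variables and with constants from $\mathcal{M}$. A set $S\subseteq \mathcal{M}^k$ is Diophantine (e-definable) in $\mathcal{M}$ if there is a finite system $\Sigma(x_1,\dots,x_k,y_1,\dots,y_m)$ of equations over $\mathcal{M}$ such that $(a_1,\dots,a_k)\in S$ if and only if $\Sigma(a_1,\dots,a_k,y_1,\dots,y_m)$ has a solution $(y_1,\dots,y_m)\in\mathcal{M}^m$. A structure $\mathcal{A}$ has a Diophantine interpretation in $\mathcal{M}$ if for some $n$ there are a Diophantine set $D\subseteq\mathcal{M}^n$ and a surjective map $\phi:D\to\mathcal{A}$ such that the preimages under $\phi$ of the equality relation of $\mathcal{A}$, of the graph of every function (and constant) of $\mathcal{A}$, and of every predicate of $\mathcal{A}$ are Diophantine in $\mathcal{M}$. For a natural number $p>0$ and $x,y\in\mathbb{Z}$ write $x\mid_p y$ if $y=x\,q\,p^f$ in $\mathbb{Q}$ for some $q,f\in\mathbb{Z}$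 ($f$ may be negative). Theorem. 1. If $\operatorname{char} K=0$, then the ring $\mathbb{Z}$ has a Diophantine interpretation in $\mathbb{A}_K(X)$. 2. If $\operatorname{char} K=p>0$, then the structure $\langle\mathbb{Z};+,\mid_p\rangle$ has a Diophantine interpretation in $\mathbb{A}_K(X)$. -/

import Mathlib

namespace EInterp
universe u v w u' v' w'

/-- A finite system of equations over an `L`-structure `M`, in free variables `x` indexed by `α`
and auxiliary variables `y` indexed by `Fin m`. An equation is a pair of `L`-terms `(s, t)`,
whose variables are of three sorts: the constants `c : M`, the variables `x`, the variables `y`. -/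
abbrev System (L : FirstOrder.Language.{u, v}) (M : Type w) (α : Type*) (m : ℕ) :=
  List (L.Term (M ⊕ (α ⊕ Fin m)) × L.Term (M ⊕ (α ⊕ Fin m)))

/-- `(x, y)` solves the system; constants are interpreted by themselves. -/
def System.IsSolution {L : FirstOrder.Language.{u, v}} {M : Type w} [L.Structure M] {α : Type*} {m : ℕ}
    (E : System L M α m) (x : α → M) (y : Fin m → M) : Prop :=
  ∀ e ∈ E, e.1.realize (Sum.elim id (Sum.elim x y)) = e.2.realize (Sum.elim id (Sum.elim x y))

/-- A set of tuples of `M` is e-definable (Diophantine) if it is the projection of the solution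
set of a finite system of equations with constants from `M`. -/
def IsDiophantine (L : FirstOrder.Language.{u, v}) {M : Type w} [L.Structure M] {α : Type*}
    (S : Set (α → M)) : Prop :=
  ∃ (m : ℕ) (E : System L M α m), ∀ x : α → M, x ∈ S ↔ ∃ y : Fin m → M, E.IsSolution x y

/-- The preimage of a `k`-ary relation `R` on `A` under `φ : D ⊆ Mⁿ → A`: the set of `k`-tuples of
elements of `D` (as `k × n` arrays over `M`) whose images are related by `R`. -/
def preimage {M : Type w} {A : Type w'} {n : ℕ} {D : Set (Fin n → M)} (φ : D → A) {k : ℕ}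
    (R : Set (Fin k → A)) : Set (Fin k × Fin n → M) :=
  {v | ∃ h : ∀ i, (fun j => v (i, j)) ∈ D, (fun i => φ ⟨fun j => v (i, j), h i⟩) ∈ R}

/-- `φ : D ⊆ Mⁿ → A` is an e-interpretation (Diophantine interpretation) of the `L'`-structure `A`
in the `L`-structure `M`. -/
structure IsEInterpretation (L' : FirstOrder.Language.{u', v'}) (L : FirstOrder.Language.{u, v}) {A : Type w'}
    [L'.Structure A] {M : Type w} [L.Structure M] {n : ℕ} (D : Set (Fin n → M)) (φ : D → A) :
    Prop where
  surjective : Function.Surjective φ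
  domain : IsDiophantine L D
  equality : IsDiophantine L (preimage φ {a : Fin 2 → A | a 0 = a 1})
  functions : ∀ (k : ℕ) (f : L'.Functions k), IsDiophantine L (preimage φ
    {a : Fin (k + 1) → A |
      FirstOrder.Language.Structure.funMap f (fun i : Fin k => a i.castSucc) = a (Fin.last k)})
  relations : ∀ (k : ℕ) (r : L'.Relations k), IsDiophantine L (preimage φ
    {a : Fin k → A | FirstOrder.Language.Structure.RelMap r a})

/-- The `L'`-structure `A` is e-interpretable (has a Diophantine interpretation) in the
`L`-structure `M`. -/
def EInterpretable (L' : FirstOrder.Language.{u', v'}) (A : Type w') [L'.Structure A]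
    (L : FirstOrder.Language.{u, v}) (M : Type w) [L.Structure M] : Prop :=
  ∃ (n : ℕ) (D : Set (Fin n → M)) (φ : D → A), IsEInterpretation L' L D φ

/-- The integers as a structure in the language of rings `(+, *, -, 0, 1)`. -/
noncomputable instance : FirstOrder.Ring.CompatibleRing ℤ :=
  FirstOrder.Ring.compatibleRingOfRing ℤ

/-- The free associative unital algebra as a structure in the language of rings. Multiplication
by scalars is multiplication by constants, so this gives all equations with constants. -/
noncomputable instance (K : Type u) [Field K] (X : Type v) :
    FirstOrder.Ring.CompatibleRing (FreeAlgebra K X) :=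
  FirstOrder.Ring.compatibleRingOfRing (FreeAlgebra K X)

/-- Localized divisibility `x ∣ₚ y` on the integers: `y = x q p ^ f` for some integers `q`, `f`
(where `f` may be negative). -/
def LocDvd (p : ℕ) (x y : ℤ) : Prop :=
  ∃ q f : ℤ, (y : ℚ) = (x : ℚ) * (q : ℚ) * (p : ℚ) ^ f

/-- The only function symbol of the language `{+, ∣ₚ}`. -/
inductive AddLocDvdFunc (p : ℕ) : ℕ → Type
  | add : AddLocDvdFunc p 2

/-- The only relation symbol of the language `{+, ∣ₚ}`. -/
inductive AddLocDvdRel (p : ℕ) : ℕ → Type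
  | locDvd : AddLocDvdRel p 2

/-- The language `{+, ∣ₚ}`. -/
def addLocDvd (p : ℕ) : FirstOrder.Language.{0, 0} := ⟨AddLocDvdFunc p, AddLocDvdRel p⟩

/-- The structure `⟨ℤ; +, ∣ₚ⟩`. -/
instance (p : ℕ) : (addLocDvd p).Structure ℤ where
  funMap {k} (f : AddLocDvdFunc p k) :=
    match k, f with
    | _, .add => fun a => a 0 + a 1
  RelMap {k} (r : AddLocDvdRel p k) :=
    match k, r with
    | _, .locDvd => fun a => LocDvd p (a 0) (a 1)

end EInterp

/-! Fix a generator `t`. Its centralizer in the free algebra is the polynomial ring `K[t]`, so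
auxiliary unknowns can be confined to `K[t]` by requiring that they commute with `t`; the problem
becomes one about polynomials in one variable.

Over `K[t]`, with `v` nonconstant and `u + u⁻¹ = v`, the equation `x² - vxy + y² = 1` says that `x -
u⁻¹y` has norm one. By descent on degrees (`norm_eq_one_iff`) the solutions are the powers `±uⁿ`,
that is `±(Sₙ(v), Sₙ₋₁(v))` for the rescaled Chebyshev polynomials. As `Sₙ(2) = n + 1`, the
congruence `x - y ≡ 1` mod `v - 2` removes the sign. Taking `v = t` codes each integer `n` by one
pair.

In characteristic 0, `Sₙ₋₁(2) = n`, so reduction modulo `t - 2` turns the ring operations of `ℤ`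
into Diophantine conditions.

In characteristic `p` this sees only `n` mod `p`. Addition is read instead from `uⁿuᵐ = uⁿ⁺ᵐ`, and
divisibility from `Sₙ₋₁ ∣ Sₘ₋₁ ↔ n ∣ m`. Multiplication by `pˢ` is visible on the trace `Cₙ = uⁿ +
u⁻ⁿ`, where it is a power of Frobenius; those powers are the Chebyshev maps compatible with `v ↦ v +
1` (`IsFrobeniusImage.exists_eq_pow`). -/

namespace EInterp

/-! ### Closure properties of Diophantine sets -/

section Closure

universe u v w u' v' w'

variable {L : FirstOrder.Language.{u, v}} {M : Type w} [L.Structure M]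

/-- Functions `Mᵅ → M` given by a term with constants from `M`. -/
def IsTermFun (L : FirstOrder.Language.{u, v}) {M : Type w} [L.Structure M] {α : Type*}
    (f : (α → M) → M) : Prop :=
  ∃ τ : L.Term (M ⊕ α), ∀ x, τ.realize (Sum.elim id x) = f x

theorem isTermFun_const {α : Type*} (c : M) : IsTermFun L (fun _ : α → M => c) :=
  ⟨.var (.inl c), fun _ => rfl⟩

theorem isTermFun_proj {α : Type*} (a : α) : IsTermFun L (fun x : α → M => x a) :=
  ⟨.var (.inr a), fun _ => rfl⟩

theorem IsTermFun.reindex {α β : Type*} {f : (α → M) → M} (hf : IsTermFun L f) (g : α → β) :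
    IsTermFun L (fun x : β → M => f (fun a => x (g a))) := by
  obtain ⟨τ, hτ⟩ := hf
  refine ⟨τ.relabel (Sum.map id g), fun x => ?_⟩
  rw [FirstOrder.Language.Term.realize_relabel]
  refine Eq.trans ?_ (hτ _)
  congr 1
  ext (a | a) <;> rfl

theorem isDiophantine_eq {α : Type*} {f g : (α → M) → M} (hf : IsTermFun L f)
    (hg : IsTermFun L g) : IsDiophantine L {x | f x = g x} := by
  obtain ⟨σ, hσ⟩ := hf
  obtain ⟨τ, hτ⟩ := hg
  refine ⟨0, [(σ.relabel (Sum.map id Sum.inl), τ.relabel (Sum.map id Sum.inl))], fun x => ?_⟩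
  have key (y : Fin 0 → M) : (Sum.elim id (Sum.elim x y) ∘ Sum.map id Sum.inl : M ⊕ α → M)
      = Sum.elim id x := by
    ext (a | a) <;> rfl
  simp [System.IsSolution, FirstOrder.Language.Term.realize_relabel, key, hσ, hτ]

theorem IsDiophantine.inter {α : Type*} {S T : Set (α → M)} (hS : IsDiophantine L S)
    (hT : IsDiophantine L T) : IsDiophantine L (S ∩ T) := by
  obtain ⟨m, E, hE⟩ := hS
  obtain ⟨n, F, hF⟩ := hT
  let i : M ⊕ (α ⊕ Fin m) → M ⊕ (α ⊕ Fin (m + n)) := Sum.map id (Sum.map id (Fin.castAdd n))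
  let j : M ⊕ (α ⊕ Fin n) → M ⊕ (α ⊕ Fin (m + n)) := Sum.map id (Sum.map id (Fin.natAdd m))
  refine ⟨m + n, E.map (fun e => (e.1.relabel i, e.2.relabel i)) ++
    F.map (fun e => (e.1.relabel j, e.2.relabel j)), fun x => ?_⟩
  have hi (y : Fin (m + n) → M) : Sum.elim id (Sum.elim x y) ∘ i =
      Sum.elim id (Sum.elim x (fun a => y (Fin.castAdd n a))) := by
    ext (a | a | a) <;> rfl
  have hj (y : Fin (m + n) → M) : Sum.elim id (Sum.elim x y) ∘ j =
      Sum.elim id (Sum.elim x (fun a => y (Fin.natAdd m a))) := by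
    ext (a | a | a) <;> rfl
  have key (y : Fin (m + n) → M) : System.IsSolution (E.map (fun e => (e.1.relabel i, e.2.relabel i))
      ++ F.map (fun e => (e.1.relabel j, e.2.relabel j))) x y ↔
      E.IsSolution x (fun a => y (Fin.castAdd n a)) ∧
      F.IsSolution x (fun a => y (Fin.natAdd m a)) := by
    simp only [System.IsSolution, List.mem_append, or_imp, forall_and, List.forall_mem_map,
      FirstOrder.Language.Term.realize_relabel, hi, hj]
  simp only [key, Set.mem_inter_iff, hE, hF]
  constructor
  · rintro ⟨⟨y, hy⟩, z, hz⟩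
    exact ⟨Fin.append y z, by simpa using hy, by simpa using hz⟩
  · rintro ⟨y, hy, hz⟩
    exact ⟨⟨_, hy⟩, _, hz⟩

theorem IsDiophantine.and {α : Type*} {P Q : (α → M) → Prop} (hP : IsDiophantine L {x | P x})
    (hQ : IsDiophantine L {x | Q x}) : IsDiophantine L {x | P x ∧ Q x} :=
  hP.inter hQ

theorem IsDiophantine.exists_fin {α : Type*} {k : ℕ} {P : (α → M) → (Fin k → M) → Prop}
    (h : IsDiophantine L {z : α ⊕ Fin k → M |
      P (fun a => z (Sum.inl a)) (fun a => z (Sum.inr a))}) :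
    IsDiophantine L {x | ∃ y, P x y} := by
  obtain ⟨m, E, hE⟩ := h
  let i : M ⊕ ((α ⊕ Fin k) ⊕ Fin m) → M ⊕ (α ⊕ Fin (k + m)) :=
    Sum.map id (Sum.elim (Sum.map id (Fin.castAdd m)) (fun a => Sum.inr (Fin.natAdd k a)))
  refine ⟨k + m, E.map (fun e => (e.1.relabel i, e.2.relabel i)), fun x => ?_⟩
  have hi (y : Fin (k + m) → M) : Sum.elim id (Sum.elim x y) ∘ i =
      Sum.elim id (Sum.elim (Sum.elim x (fun a => y (Fin.castAdd m a)))
        (fun a => y (Fin.natAdd k a))) := by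
    ext (a | (a | a) | a) <;> rfl
  have key (y : Fin (k + m) → M) :
      System.IsSolution (E.map (fun e => (e.1.relabel i, e.2.relabel i))) x y ↔
      E.IsSolution (Sum.elim x (fun a => y (Fin.castAdd m a))) (fun a => y (Fin.natAdd k a)) := by
    simp only [System.IsSolution, List.forall_mem_map,
      FirstOrder.Language.Term.realize_relabel, hi]
  simp only [key, Set.mem_ofPred_eq]
  constructor
  · rintro ⟨y, hy⟩
    obtain ⟨z, hz⟩ := (hE (Sum.elim x y)).1 hy
    exact ⟨Fin.append y z, by simpa using hz⟩
  · rintro ⟨y, hy⟩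
    exact ⟨_, (hE (Sum.elim x _)).2 ⟨_, hy⟩⟩

theorem IsDiophantine.reindex {α β : Type*} {S : Set (α → M)} (hS : IsDiophantine L S)
    (g : α → β) : IsDiophantine L {x : β → M | (fun a => x (g a)) ∈ S} := by
  obtain ⟨m, E, hE⟩ := hS
  let i : M ⊕ (α ⊕ Fin m) → M ⊕ (β ⊕ Fin m) := Sum.map id (Sum.map g id)
  refine ⟨m, E.map (fun e => (e.1.relabel i, e.2.relabel i)), fun x => ?_⟩
  have hi (y : Fin m → M) : Sum.elim id (Sum.elim x y) ∘ i =
      Sum.elim id (Sum.elim (fun a => x (g a)) y) := by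
    ext (a | a | a) <;> rfl
  simp only [System.IsSolution, List.forall_mem_map, Set.mem_ofPred_eq, hE,
      FirstOrder.Language.Term.realize_relabel, hi]

theorem isDiophantine_univ {α : Type*} : IsDiophantine L (Set.univ : Set (α → M)) :=
  ⟨0, [], fun x => by simp [System.IsSolution]⟩

theorem isDiophantine_forall_finset {α ι : Type*} (s : Finset ι) {P : ι → (α → M) → Prop}
    (h : ∀ i, IsDiophantine L {x | P i x}) : IsDiophantine L {x | ∀ i ∈ s, P i x} := by
  classical
  induction s using Finset.induction_on with
  | empty => simpa using! isDiophantine_univ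
  | insert a s _ ih =>
    simp only [Finset.forall_mem_insert]
    exact (h a).and ih

theorem isDiophantine_forall {α ι : Type*} [Fintype ι] {P : ι → (α → M) → Prop}
    (h : ∀ i, IsDiophantine L {x | P i x}) : IsDiophantine L {x | ∀ i, P i x} := by
  simpa using isDiophantine_forall_finset Finset.univ h

/-- A structure parametrized injectively by a Diophantine set of tuples, such that its operations
and relations are cut out by Diophantine conditions on these tuples, is e-interpretable. -/
theorem eInterpretable_of_injective {L' : FirstOrder.Language.{u', v'}} {A : Type w'}
    [L'.Structure A] {n : ℕ} (e : A → Fin n → M) (he : Function.Injective e)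
    (hD : IsDiophantine L (Set.range e))
    (hf : ∀ (k : ℕ) (f : L'.Functions k), ∃ T : Set (Fin (k + 1) × Fin n → M),
      IsDiophantine L T ∧ ∀ a : Fin (k + 1) → A, (fun v => e (a v.1) v.2) ∈ T ↔
        FirstOrder.Language.Structure.funMap f (fun i : Fin k => a i.castSucc) = a (Fin.last k))
    (hr : ∀ (k : ℕ) (r : L'.Relations k), ∃ T : Set (Fin k × Fin n → M),
      IsDiophantine L T ∧ ∀ a : Fin k → A, (fun v => e (a v.1) v.2) ∈ T ↔
        FirstOrder.Language.Structure.RelMap r a) :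
    EInterpretable L' A L M := by
  let φ : Set.range e → A := fun d => d.2.choose
  have hφ (a : A) (h : e a ∈ Set.range e) : φ ⟨e a, h⟩ = a := he h.choose_spec
  have key (k : ℕ) (R : Set (Fin k → A)) (T : Set (Fin k × Fin n → M)) (hT : IsDiophantine L T)
      (hTR : ∀ a : Fin k → A, (fun v => e (a v.1) v.2) ∈ T ↔ a ∈ R) :
      IsDiophantine L (preimage φ R) := by
    have hS : IsDiophantine L {v : Fin k × Fin n → M | ∀ i, (fun j => v (i, j)) ∈ Set.range e} :=
      isDiophantine_forall fun i => hD.reindex fun j => (i, j)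
    have hrange {v : Fin k × Fin n → M} (h : ∀ i, (fun j => v (i, j)) ∈ Set.range e) :
        ∃ a : Fin k → A, v = fun v => e (a v.1) v.2 := by
      choose a ha using h
      exact ⟨a, funext fun ⟨i, j⟩ => (congrFun (ha i) j).symm⟩
    convert hS.inter hT using 1
    ext v
    constructor
    · rintro ⟨h, hR⟩
      refine ⟨h, ?_⟩
      obtain ⟨a, rfl⟩ := hrange h
      rw [hTR]
      simpa only [hφ] using hR
    · rintro ⟨h, hvT⟩
      refine ⟨h, ?_⟩
      obtain ⟨a, rfl⟩ := hrange h
      rw [hTR] at hvT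
      simpa only [hφ] using hvT
  refine ⟨n, Set.range e, φ, fun a => ⟨⟨e a, a, rfl⟩, hφ a _⟩, hD, ?_, fun k f => ?_, fun k r => ?_⟩
  -- Codes are unique, so equality in `A` is coordinatewise equality of codes.
  · refine key 2 _ {v | ∀ j, v (0, j) = v (1, j)}
      (isDiophantine_forall fun j => isDiophantine_eq (isTermFun_proj _) (isTermFun_proj _))
      fun a => ?_
    exact ⟨fun h => he (funext h), fun h j => congrFun (congrArg e h) j⟩
  · obtain ⟨T, hT, h⟩ := hf k f
    exact key _ _ T hT h
  · obtain ⟨T, hT, h⟩ := hr k r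
    exact key _ _ T hT h

end Closure

/-! ### Ring operations on term functions -/

section RingTerms

open FirstOrder FirstOrder.Ring

variable {M : Type*} [Ring M] [CompatibleRing M] {α : Type*} {f g : (α → M) → M}

theorem IsTermFun.add (hf : IsTermFun Language.ring f) (hg : IsTermFun Language.ring g) :
    IsTermFun Language.ring (fun x => f x + g x) := by
  obtain ⟨σ, hσ⟩ := hf
  obtain ⟨τ, hτ⟩ := hg
  exact ⟨σ + τ, fun x => by simp [hσ, hτ]⟩

theorem IsTermFun.mul (hf : IsTermFun Language.ring f) (hg : IsTermFun Language.ring g) :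
    IsTermFun Language.ring (fun x => f x * g x) := by
  obtain ⟨σ, hσ⟩ := hf
  obtain ⟨τ, hτ⟩ := hg
  exact ⟨σ * τ, fun x => by simp [hσ, hτ]⟩

theorem IsTermFun.neg (hf : IsTermFun Language.ring f) :
    IsTermFun Language.ring (fun x => -f x) := by
  obtain ⟨σ, hσ⟩ := hf
  exact ⟨-σ, fun x => by simp [hσ]⟩

theorem IsTermFun.sub (hf : IsTermFun Language.ring f) (hg : IsTermFun Language.ring g) :
    IsTermFun Language.ring (fun x => f x - g x) := by
  simpa only [sub_eq_add_neg] using hf.add hg.neg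

end RingTerms

end EInterp

namespace EInterp

/-! ### Chebyshev polynomials: addition law, degrees, divisibility -/

section ChebyshevEquation

open Polynomial

variable (R : Type*) [CommRing R]

/-- With `X = u + u⁻¹` one has `uⁿ = Sₙ - u⁻¹Sₙ₋₁`; this is the constant coefficient of `uᵃuᵇ` in
the basis `1, u⁻¹`. -/
theorem chebyshev_S_add (a b : ℤ) : Chebyshev.S R (a + b) =
    Chebyshev.S R a * Chebyshev.S R b - Chebyshev.S R (a - 1) * Chebyshev.S R (b - 1) := by
  induction b using Polynomial.Chebyshev.induct with
  | zero => simp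
  | one => simp [Chebyshev.S_add_one, mul_comm]
  | add_two n ih1 ih2 =>
    have h1 := Chebyshev.S_add_two R (a + n)
    have h2 := Chebyshev.S_add_two R n
    have h3 := Chebyshev.S_add_two R (n - 1 : ℤ)
    rw [show (n : ℤ) - 1 + 2 = n + 1 by ring, show (n : ℤ) - 1 + 1 = n by ring] at h3
    rw [show a + n + 2 = a + (n + 2) by ring, show a + n + 1 = a + (n + 1) by ring] at h1
    rw [show (n : ℤ) + 1 - 1 = n by ring] at ih1
    rw [show (n : ℤ) + 2 - 1 = n + 1 by ring]
    linear_combination h1 + (X : R[X]) * ih1 - ih2 - Chebyshev.S R a * h2 +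
      Chebyshev.S R (a - 1) * h3
  | neg_add_one n ih1 ih2 =>
    have h1 := Chebyshev.S_sub_one R (a + -n)
    have h2 := Chebyshev.S_sub_one R (-n)
    have h3 := Chebyshev.S_sub_one R (-n - 1)
    rw [show -(n : ℤ) - 1 + 1 = -n by ring] at h3
    rw [show a + -(n : ℤ) - 1 = a + (-n - 1) by ring,
      show a + -(n : ℤ) + 1 = a + (-n + 1) by ring] at h1
    rw [show -(n : ℤ) + 1 - 1 = -n by ring] at ih2
    linear_combination h1 + (X : R[X]) * ih1 - ih2 - Chebyshev.S R a * h2 +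
      Chebyshev.S R (a - 1) * h3

variable {R}

/-- The equation satisfied by consecutive Chebyshev polynomials of the second kind (in their
Vieta–Fibonacci normalization), and the congruence that fixes the sign of a solution. -/
def IsChebyshevPair (v x y : R) : Prop :=
  x * x - v * x * y + y * y = 1 ∧ v - 2 ∣ x - y - 1

theorem isChebyshevPair_S (v : R[X]) (n : ℤ) :
    IsChebyshevPair v ((Chebyshev.S R n).comp v) ((Chebyshev.S R (n - 1)).comp v) := by
  constructor
  · have h := congrArg (fun q => q.comp v) (Chebyshev.S_sq_add_S_sq R (n - 1))
    simp only [sub_add_cancel, sub_comp, add_comp, mul_comp, pow_comp, X_comp, one_comp] at h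
    linear_combination h
  -- At 2 the difference is `(n + 1) - n - 1 = 0`.
  · have h : (X - C 2 : R[X]) ∣ Chebyshev.S R n - Chebyshev.S R (n - 1) - 1 := by
      rw [dvd_iff_isRoot]
      simp
    rw [C_ofNat] at h
    obtain ⟨q, hq⟩ := h
    refine ⟨q.comp v, ?_⟩
    simpa using congrArg (fun q => q.comp v) hq

/-- The left side is the trace of `x - u⁻¹y`, here of `uⁿ`. -/
theorem trace_S_comp (v : R[X]) (n : ℤ) :
    2 * (Chebyshev.S R n).comp v - v * (Chebyshev.S R (n - 1)).comp v =
      (Chebyshev.C R n).comp v := by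
  simp [Chebyshev.C_eq_S_sub_X_mul_S]

theorem monic_S_natDegree_S [Nontrivial R] (n : ℕ) :
    (Chebyshev.S R n).Monic ∧ (Chebyshev.S R n).natDegree = n := by
  induction n using Nat.twoStepInduction with
  | zero => simp
  | one => simp [monic_X]
  | more n ih1 ih2 =>
    push_cast at ih2 ⊢
    have h1 : (X * Chebyshev.S R (n + 1)).natDegree = n + 2 := by
      rw [monic_X.natDegree_mul ih2.1, natDegree_X, ih2.2]
      ring
    rw [Chebyshev.S_add_two]
    refine ⟨(monic_X.mul ih2.1).sub_of_left (degree_lt_degree ?_), ?_⟩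
    · rw [h1, ih1.2]
      lia
    · rw [natDegree_sub_eq_left_of_natDegree_lt, h1]
      rw [h1, ih1.2]
      lia

theorem monic_C_natDegree_C [Nontrivial R] (n : ℕ) (hn : 0 < n) :
    (Chebyshev.C R n).Monic ∧ (Chebyshev.C R n).natDegree = n := by
  obtain ⟨n, rfl⟩ := Nat.exists_eq_add_of_lt hn
  clear hn
  rw [zero_add]
  induction n using Nat.twoStepInduction with
  | zero => simp [monic_X]
  | one =>
    norm_num
    rw [Chebyshev.C_two]
    exact ⟨monic_X_pow_sub_C (2 : R) two_ne_zero, natDegree_X_pow_sub_C⟩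
  | more n ih1 ih2 =>
    push_cast at ih1 ih2 ⊢
    have h1 : (X * Chebyshev.C R (n + 1 + 1)).natDegree = n + 3 := by
      rw [monic_X.natDegree_mul ih2.1, natDegree_X, ih2.2]
      ring
    rw [show (n : ℤ) + 2 + 1 = n + 1 + 2 by ring, Chebyshev.C_add_two]
    refine ⟨(monic_X.mul ih2.1).sub_of_left (degree_lt_degree ?_), ?_⟩
    · rw [h1, ih1.2]
      lia
    · rw [natDegree_sub_eq_left_of_natDegree_lt, h1]
      rw [h1, ih1.2]
      lia

theorem natDegree_C [Nontrivial R] (n : ℤ) : (Chebyshev.C R n).natDegree = n.natAbs := by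
  rw [← Chebyshev.C_natAbs]
  rcases Nat.eq_zero_or_pos n.natAbs with h | h
  · rw [h]
    simp
  · exact (monic_C_natDegree_C _ h).2

theorem natDegree_S_sub_one [Nontrivial R] (n : ℤ) :
    (Chebyshev.S R (n - 1)).natDegree = n.natAbs - 1 := by
  rcases lt_trichotomy n 0 with h | rfl | h
  · obtain ⟨k, rfl⟩ : ∃ k : ℕ, n = -(k + 1) := ⟨(-n - 1).toNat, by lia⟩
    rw [Chebyshev.S_neg_sub_one, natDegree_neg, add_sub_cancel_right, (monic_S_natDegree_S k).2]
    lia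
  -- `S₋₁ = 0` has `natDegree` 0, which agrees with the truncated `0 - 1`.
  · simp
  · obtain ⟨k, rfl⟩ : ∃ k : ℕ, n = k + 1 := ⟨(n - 1).toNat, by lia⟩
    rw [add_sub_cancel_right, (monic_S_natDegree_S k).2]
    lia

theorem S_sub_one_ne_zero [Nontrivial R] {n : ℤ} (hn : n ≠ 0) : Chebyshev.S R (n - 1) ≠ 0 := by
  rcases lt_or_gt_of_ne hn with h | h
  · obtain ⟨k, rfl⟩ : ∃ k : ℕ, n = -(k + 1) := ⟨(-n - 1).toNat, by lia⟩
    rw [Chebyshev.S_neg_sub_one, add_sub_cancel_right]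
    exact neg_ne_zero.2 (monic_S_natDegree_S k).1.ne_zero
  · obtain ⟨k, rfl⟩ : ∃ k : ℕ, n = k + 1 := ⟨(n - 1).toNat, by lia⟩
    rw [add_sub_cancel_right]
    exact (monic_S_natDegree_S k).1.ne_zero

theorem S_sub_one_dvd_mul (n q : ℤ) : Chebyshev.S R (n - 1) ∣ Chebyshev.S R (n * q - 1) := by
  have step (a : ℤ) : Chebyshev.S R (a + n - 1) =
      Chebyshev.S R a * Chebyshev.S R (n - 1) - Chebyshev.S R (a - 1) * Chebyshev.S R (n - 2) := by
    rw [add_sub_assoc, chebyshev_S_add]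
    ring_nf
  have step' (a : ℤ) : Chebyshev.S R (a - n - 1) =
      Chebyshev.S R (a - 1) * Chebyshev.S R (-n) + Chebyshev.S R (a - 1 - 1) *
        Chebyshev.S R (n - 1) := by
    rw [show a - n - 1 = (a - 1) + -n by ring, chebyshev_S_add, Chebyshev.S_neg_sub_one]
    ring
  induction q with
  | zero => simp
  | succ q ih =>
    rw [mul_add, mul_one, step]
    exact dvd_sub (dvd_mul_left _ _) (ih.mul_right _)
  | pred q ih =>
    rw [mul_sub, mul_one, step']
    exact dvd_add (ih.mul_right _) (dvd_mul_left _ _)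

theorem isCoprime_S (n : ℤ) : IsCoprime (Chebyshev.S R n) (Chebyshev.S R (n - 1)) := by
  have h := Chebyshev.S_sq_add_S_sq R (n - 1)
  rw [sub_add_cancel] at h
  exact ⟨Chebyshev.S R n - X * Chebyshev.S R (n - 1), Chebyshev.S R (n - 1), by
    linear_combination h⟩

/-- Division with remainder on indices: the addition law and coprimality of consecutive `S` reduce
`m` to `m % n`, where the degree is too small unless the remainder is 0. -/
theorem S_sub_one_dvd_iff [IsDomain R] (n m : ℤ) :
    Chebyshev.S R (n - 1) ∣ Chebyshev.S R (m - 1) ↔ n ∣ m := by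
  constructor
  · intro h
    rcases eq_or_ne n 0 with rfl | hn
    · simp only [zero_sub, Chebyshev.S_neg_one, zero_dvd_iff] at h
      rw [zero_dvd_iff]
      by_contra hm
      exact S_sub_one_ne_zero hm h
    · have hq := S_sub_one_dvd_mul (R := R) n (m / n)
      have hr : Chebyshev.S R (m - 1) = Chebyshev.S R (n * (m / n)) * Chebyshev.S R (m % n - 1) -
          Chebyshev.S R (n * (m / n) - 1) * Chebyshev.S R (m % n - 1 - 1) := by
        rw [← chebyshev_S_add, ← add_sub_assoc, Int.mul_ediv_add_emod]
      have h' : Chebyshev.S R (n - 1) ∣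
          Chebyshev.S R (n * (m / n)) * Chebyshev.S R (m % n - 1) := by
        have := dvd_add h (hq.mul_right (Chebyshev.S R (m % n - 1 - 1)))
        rwa [hr, sub_add_cancel] at this
      have hc : IsCoprime (Chebyshev.S R (n - 1)) (Chebyshev.S R (n * (m / n))) :=
        ((isCoprime_S _).of_isCoprime_of_dvd_right hq).symm
      have h'' := hc.dvd_of_dvd_mul_left h'
      rw [Int.dvd_iff_emod_eq_zero]
      by_contra hm
      have := natDegree_le_of_dvd h'' (S_sub_one_ne_zero hm)
      rw [natDegree_S_sub_one, natDegree_S_sub_one] at this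
      have := Int.abs_eq_natAbs n ▸ Int.emod_lt_abs m hn
      have := Int.emod_nonneg m hn
      lia
  · rintro ⟨q, rfl⟩
    exact S_sub_one_dvd_mul n q

/-- The addition law for `n + (-m - 1)` gives `Sₙ₋ₘ₋₁ = 0`, which forces `n = m` in any
characteristic. -/
theorem S_injective [Nontrivial R] {n m : ℤ} (h : Chebyshev.S R n = Chebyshev.S R m)
    (h' : Chebyshev.S R (n - 1) = Chebyshev.S R (m - 1)) : n = m := by
  by_contra hne
  apply S_sub_one_ne_zero (R := R) (sub_ne_zero.2 hne)
  have h1 := chebyshev_S_add R n (-m - 1)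
  have h2 := Chebyshev.S_sub_one R m
  rw [Chebyshev.S_neg_sub_one, show -m - 1 - 1 = -(m + 1) - 1 by ring, Chebyshev.S_neg_sub_one,
    add_sub_cancel_right, h, h'] at h1
  rw [show n - m - 1 = n + (-m - 1) by ring, h1]
  ring

/-! ### Solutions of the norm equation over a field -/

variable {K : Type*} [Field K]

/-- Vieta descent: `(x, y) ↦ (y, vy - x)` is division by `u` and lowers the total degree when `deg y
< deg x`. In equal degrees the term `vxy` dominates, so one coordinate vanishes. -/
theorem norm_eq_one_iff {v x y : K[X]} (hv : 0 < v.natDegree)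
    (h : x * x - v * x * y + y * y = 1) : ∃ n : ℤ,
    (x = (Chebyshev.S K n).comp v ∧ y = (Chebyshev.S K (n - 1)).comp v) ∨
    (x = -(Chebyshev.S K n).comp v ∧ y = -(Chebyshev.S K (n - 1)).comp v) := by
  induction hN : x.natDegree + y.natDegree using Nat.strong_induction_on generalizing x y with
  | _ N ih =>
  subst hN
  wlog hle : y.natDegree ≤ x.natDegree generalizing x y
  · obtain ⟨n, hn⟩ := this (x := y) (y := x) (by linear_combination h)
      (fun m hm x' y' hxy he => ih m (by lia) hxy he) (by lia)
    -- Swapping the coordinates sends index `n` to `-n - 1` and changes the sign.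
    refine ⟨-n - 1, ?_⟩
    rw [show -n - 1 - 1 = -(n + 1) - 1 by ring, Chebyshev.S_neg_sub_one, Chebyshev.S_neg_sub_one,
      add_sub_cancel_right, neg_comp, neg_comp, neg_neg, neg_neg]
    tauto
  have hv0 : v ≠ 0 := by
    rintro rfl
    simp at hv
  rcases hle.eq_or_lt with heq | hlt
  · rcases eq_or_ne x 0 with rfl | hx
    · have : (y - 1) * (y + 1) = 0 := by linear_combination h
      refine ⟨-1, ?_⟩
      rcases mul_eq_zero.1 this with h | h
      · right
        norm_num [Chebyshev.S_neg_two]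
        linear_combination h
      · left
        norm_num [Chebyshev.S_neg_two]
        linear_combination h
    rcases eq_or_ne y 0 with rfl | hy
    · have : (x - 1) * (x + 1) = 0 := by linear_combination h
      refine ⟨0, ?_⟩
      rcases mul_eq_zero.1 this with h | h
      · left
        norm_num
        linear_combination h
      · right
        norm_num
        linear_combination h
    exfalso
    have h1 : v * x * y = x * x + y * y - 1 := by linear_combination -h
    have h2 : (v * x * y).natDegree = v.natDegree + x.natDegree + y.natDegree := by
      rw [natDegree_mul (mul_ne_zero hv0 hx) hy, natDegree_mul hv0 hx]
    have h3 : (x * x + y * y - 1).natDegree ≤ x.natDegree + x.natDegree := by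
      compute_degree
      lia
    rw [← h1] at h3
    lia
  · have hx : x ≠ 0 := by
      rintro rfl
      simp at hlt
    have h1 : x * (v * y - x) = y * y - 1 := by linear_combination -h
    have h2 : (v * y - x).natDegree < x.natDegree := by
      rcases eq_or_ne (v * y - x) 0 with h0 | h0
      · rw [h0, natDegree_zero]
        lia
      · have h3 := natDegree_mul hx h0
        have h4 : (y * y - 1).natDegree ≤ y.natDegree + y.natDegree := by
          compute_degree
        rw [← h1] at h4
        lia
    obtain ⟨n, hn⟩ := ih _ (by lia) (x := y) (y := v * y - x) (by linear_combination h) rfl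
    refine ⟨n + 1, ?_⟩
    rw [add_sub_cancel_right, Chebyshev.S_add_one, sub_comp, mul_comp, X_comp]
    rcases hn with ⟨h3, h4⟩ | ⟨h3, h4⟩
    · left
      exact ⟨by rw [← h3, ← h4]; ring, h3⟩
    · right
      refine ⟨?_, h3⟩
      linear_combination v * h3 - h4

theorem isChebyshevPair_iff {v x y : K[X]} (hv : 0 < v.natDegree) : IsChebyshevPair v x y ↔
    ∃ n : ℤ, x = (Chebyshev.S K n).comp v ∧ y = (Chebyshev.S K (n - 1)).comp v := by
  constructor
  · rintro ⟨h1, h2⟩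
    obtain ⟨n, h | ⟨h3, h4⟩⟩ := norm_eq_one_iff hv h1
    · exact ⟨n, h⟩
    -- The congruences for a pair and its negative add up to `v - 2 ∣ -2`; as `v` is nonconstant
    -- this forces `2 = 0`, and then the signs coincide.
    · have h5 := dvd_add h2 (isChebyshevPair_S v n).2
      rw [h3, h4, show ∀ a b : K[X], -a - -b - 1 + (a - b - 1) = C (-2) by
        intro a b
        simp only [map_neg, map_ofNat]
        ring] at h5
      have h6 : (2 : K) = 0 := by
        by_contra h0
        have := natDegree_le_of_dvd h5 (by simpa using h0)
        rw [Polynomial.natDegree_C, ← C_ofNat, natDegree_sub_C] at this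
        lia
      have h7 (a : K[X]) : -a = a := by
        have : (2 : K[X]) = 0 := by rw [← C_ofNat, h6, C_0]
        linear_combination -a * this
      rw [h7] at h3 h4
      exact ⟨n, h3, h4⟩
  · rintro ⟨n, rfl, rfl⟩
    exact isChebyshevPair_S v n

/-! ### Frobenius powers and localized divisibility in characteristic `p` -/

theorem C_prime_pow (p : ℕ) [Fact p.Prime] [CharP K p] (s : ℕ) :
    Chebyshev.C K (p ^ s : ℕ) = X ^ p ^ s := by
  induction s with
  | zero => simp
  | succ s ih =>
    rw [pow_succ, Nat.cast_mul, Chebyshev.C_mul, ih, ← dickson_one_one_eq_chebyshev_C,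
      dickson_one_one_charP, pow_comp, X_comp, ← pow_mul, mul_comm]

theorem C_prime_pow_mul (p : ℕ) [Fact p.Prime] [CharP K p] (s : ℕ) (n : ℤ) :
    Chebyshev.C K ((p ^ s : ℕ) * n) = Chebyshev.C K n ^ p ^ s := by
  rw [Chebyshev.C_mul, C_prime_pow, pow_comp, X_comp]

/-- Compare coefficients of `Xⁿ⁻¹`: the shift adds `n` to it since `Cₙ` is monic of degree `n`,
while the constant 1 does not reach it because `n ≥ 2`. -/
theorem natCast_eq_zero_of_taylor_C {n : ℕ} (hn : 2 ≤ n)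
    (h : (Chebyshev.C K n).comp (X + 1) = Chebyshev.C K n + 1) : (n : K) = 0 := by
  obtain ⟨hm, hd⟩ := monic_C_natDegree_C (R := K) n (by lia)
  obtain ⟨k, rfl⟩ := Nat.exists_eq_add_of_le' hn
  have h1 := congrArg (fun q => coeff q (k + 1)) h
  simp only [← C_1 (R := K)] at h1
  rw [← taylor_apply, taylor_coeff, coeff_add, coeff_C_succ, add_zero] at h1
  have h2 : (hasseDeriv (k + 1) (Chebyshev.C K (k + 2 : ℕ))).natDegree < 2 := by
    have := natDegree_hasseDeriv_le (Chebyshev.C K (k + 2 : ℕ)) (k + 1)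
    lia
  have h3 : (Chebyshev.C K (k + 2 : ℕ)).coeff (k + 2) = 1 := by
    have := hm.coeff_natDegree
    rwa [hd] at this
  rw [eval_eq_sum_range' h2, Finset.sum_range_succ, Finset.sum_range_one, hasseDeriv_coeff,
    hasseDeriv_coeff, zero_add, Nat.choose_self, show 1 + (k + 1) = k + 2 by ring, h3] at h1
  rw [show k + 2 = (k + 1) + 1 from rfl, Nat.choose_succ_self_right] at h1
  simp only [Nat.cast_one, one_mul, pow_zero, mul_one, one_pow, add_eq_left] at h1
  exact h1

/-- The Diophantine condition on polynomials over a field of characteristic `p` saying, for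
nonconstant `v`, that `z` is the image of `v` under a power of the Frobenius map. -/
def IsFrobeniusImage (v z : R) : Prop :=
  (∃ x y, IsChebyshevPair v x y ∧ z = 2 * x - v * y) ∧
    ∃ x y, IsChebyshevPair (v + 1) x y ∧ z + 1 = 2 * x - (v + 1) * y

theorem isFrobeniusImage_pow (p : ℕ) [Fact p.Prime] [CharP K p] (v : K[X]) (s : ℕ) :
    IsFrobeniusImage v (v ^ p ^ s) := by
  refine ⟨⟨_, _, isChebyshevPair_S v (p ^ s : ℕ), ?_⟩,
    ⟨_, _, isChebyshevPair_S (v + 1) (p ^ s : ℕ), ?_⟩⟩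
  · rw [trace_S_comp, C_prime_pow, pow_comp, X_comp]
  · rw [trace_S_comp, C_prime_pow, pow_comp, X_comp, add_pow_char_pow, one_pow]

theorem IsFrobeniusImage.exists_eq_pow (p : ℕ) [Fact p.Prime] [CharP K p] {v z : K[X]}
    (hv : 0 < v.natDegree) (h : IsFrobeniusImage v z) : ∃ s, z = v ^ p ^ s := by
  have hp : p.Prime := Fact.out
  obtain ⟨⟨x, y, hxy, hz⟩, x', y', hxy', hz'⟩ := h
  have hdeg : (v + 1).natDegree = v.natDegree := natDegree_add_C (a := 1)
  obtain ⟨n, rfl, rfl⟩ := (isChebyshevPair_iff hv).1 hxy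
  obtain ⟨m, rfl, rfl⟩ := (isChebyshevPair_iff (hdeg ▸ hv)).1 hxy'
  rw [trace_S_comp] at hz hz'
  -- Adding 1 preserves degrees, so both indices agree up to sign, and `C` is even in its index.
  have hnm : n.natAbs = m.natAbs := by
    have h1 : (z + 1).natDegree = z.natDegree := natDegree_add_C (a := 1)
    rw [hz', hz, natDegree_comp, natDegree_comp, natDegree_C, natDegree_C, hdeg] at h1
    exact (Nat.eq_of_mul_eq_mul_right hv h1).symm
  rw [← Chebyshev.C_natAbs] at hz hz'
  rw [← hnm] at hz'
  generalize n.natAbs = a at hz hz'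
  have key : (Chebyshev.C K a).comp (X + 1) = Chebyshev.C K a + 1 := by
    rw [← sub_eq_zero]
    have h1 : ((Chebyshev.C K a).comp (X + 1) - (Chebyshev.C K a + 1)).comp v = 0 := by
      rw [sub_comp, comp_assoc, add_comp, add_comp, X_comp, one_comp, ← hz, ← hz', sub_self]
    rcases comp_eq_zero_iff.1 h1 with h2 | ⟨_, h2⟩
    · exact h2
    · rw [h2, Polynomial.natDegree_C] at hv
      lia
  rcases Nat.eq_zero_or_pos a with rfl | ha
  · simp at key
  obtain ⟨s, b, hb, rfl⟩ := Nat.exists_eq_pow_mul_and_not_dvd ha.ne' p hp.ne_one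
  rw [Nat.cast_mul, C_prime_pow_mul] at key hz
  -- Injectivity of Frobenius strips the `p`-part of the index; the prime-to-`p` part must then be
  -- 1.
  have key' : (Chebyshev.C K b).comp (X + 1) = Chebyshev.C K b + 1 := by
    apply iterateFrobenius_inj K[X] p s
    simp only [iterateFrobenius_def]
    rw [add_pow_char_pow, one_pow, ← key, pow_comp]
  have hb1 : b = 1 := by
    have hb0 : b ≠ 0 := by
      rintro rfl
      simp at hb
    by_contra hb1
    exact hb ((CharP.cast_eq_zero_iff K p b).1 (natCast_eq_zero_of_taylor_C (by lia) key'))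
  subst hb1
  exact ⟨s, by simpa using hz⟩

theorem locDvd_iff {p : ℕ} (hp : p.Prime) (n m : ℤ) :
    LocDvd p n m ↔ ∃ s : ℕ, n ∣ (p ^ s : ℕ) * m := by
  have hp0 : (p : ℚ) ≠ 0 := by exact_mod_cast hp.ne_zero
  constructor
  · rintro ⟨q, f, h⟩
    rcases le_total 0 f with hf | hf
    · lift f to ℕ using hf
      refine ⟨0, q * p ^ f, ?_⟩
      rw [zpow_natCast] at h
      have : m = n * q * p ^ f := by exact_mod_cast h
      rw [this]
      simp [mul_assoc]
    · obtain ⟨s, rfl⟩ := Int.exists_eq_neg_ofNat hf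
      refine ⟨s, q, ?_⟩
      rw [zpow_neg, zpow_natCast, eq_mul_inv_iff_mul_eq₀ (pow_ne_zero _ hp0)] at h
      have : m * p ^ s = n * q := by exact_mod_cast h
      rw [← this]
      push_cast
      ring
  · rintro ⟨s, q, h⟩
    refine ⟨q, -s, ?_⟩
    rw [zpow_neg, zpow_natCast, eq_mul_inv_iff_mul_eq₀ (pow_ne_zero _ hp0)]
    have : m * p ^ s = n * q := by
      rw [← h]
      push_cast
      ring
    exact_mod_cast this

/-- The trace determines `k` only up to sign, `k = ±pˢm`, which is harmless for divisibility. -/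
theorem locDvd_iff_exists_isFrobeniusImage (p : ℕ) [Fact p.Prime] [CharP K p] (n m : ℤ) :
    LocDvd p n m ↔ ∃ k : ℤ, IsFrobeniusImage (Chebyshev.C K m) (Chebyshev.C K k) ∧
      Chebyshev.S K (n - 1) ∣ Chebyshev.S K (k - 1) := by
  rw [locDvd_iff Fact.out]
  constructor
  · rintro ⟨s, hs⟩
    refine ⟨_, ?_, (S_sub_one_dvd_iff _ _).2 hs⟩
    rw [C_prime_pow_mul]
    exact isFrobeniusImage_pow p _ s
  · rintro ⟨k, hk, hd⟩
    rw [S_sub_one_dvd_iff] at hd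
    -- For `m = 0` the trace is the constant 2 and the Frobenius analysis does not apply, but every
    -- `n` divides 0.
    rcases eq_or_ne m 0 with rfl | hm
    · exact ⟨0, by simp⟩
    · obtain ⟨s, hs⟩ := hk.exists_eq_pow p (by rw [natDegree_C]; lia)
      refine ⟨s, ?_⟩
      rw [← C_prime_pow_mul] at hs
      have := congrArg natDegree hs
      rw [natDegree_C, natDegree_C] at this
      exact hd.trans (Int.natAbs_dvd_natAbs.1 (dvd_of_eq this))

end ChebyshevEquation

end EInterp

namespace EInterp

/-! ### The polynomial conditions relativized to a centralizer -/

section Conditions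

open FirstOrder

variable {M : Type*} [Ring M]

/-- Divisibility of `b` by `a` on the left, with a quotient that commutes with `t`. -/
def CommDvd (t a b : M) : Prop :=
  ∃ w, t * w = w * t ∧ b = a * w

/-- The pairs in the centralizer of `t` satisfying the conditions of `IsChebyshevPair`. -/
def IsCommChebyshevPair (t v x y : M) : Prop :=
  t * x = x * t ∧ t * y = y * t ∧ x * x - v * x * y + y * y = 1 ∧ CommDvd t (v - 2) (x - y - 1)

/-- The condition `IsFrobeniusImage` with auxiliary elements in the centralizer of `t`. -/
def IsCommFrobeniusImage (t v z : M) : Prop :=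
  (∃ a : Fin 2 → M, IsCommChebyshevPair t v (a 0) (a 1) ∧ z = 2 * a 0 - v * a 1) ∧
    ∃ a : Fin 2 → M, IsCommChebyshevPair t (v + 1) (a 0) (a 1) ∧ z + 1 = 2 * a 0 - (v + 1) * a 1

variable [Ring.CompatibleRing M] {α : Type*} {f g h : (α → M) → M}

theorem isDiophantine_commDvd (t : M) (hf : IsTermFun Language.ring f)
    (hg : IsTermFun Language.ring g) :
    IsDiophantine Language.ring {x | CommDvd t (f x) (g x)} := by
  have h1 : IsDiophantine Language.ring {x : α → M | ∃ w : Fin 1 → M,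
      t * w 0 = w 0 * t ∧ g x = f x * w 0} :=
    have hw := isTermFun_proj (L := Language.ring) (M := M) (Sum.inr (0 : Fin 1) : α ⊕ Fin 1)
    IsDiophantine.exists_fin <| (isDiophantine_eq ((isTermFun_const t).mul hw)
      (hw.mul (isTermFun_const t))).and (isDiophantine_eq (hg.reindex _) ((hf.reindex _).mul hw))
  convert h1 using 4 with x
  exact ⟨fun ⟨w, hw⟩ => ⟨fun _ => w, hw⟩, fun ⟨w, hw⟩ => ⟨w 0, hw⟩⟩

theorem isDiophantine_isCommChebyshevPair (t : M) (hf : IsTermFun Language.ring f)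
    (hg : IsTermFun Language.ring g) (hh : IsTermFun Language.ring h) :
    IsDiophantine Language.ring {x | IsCommChebyshevPair t (f x) (g x) (h x)} :=
  (isDiophantine_eq ((isTermFun_const t).mul hg) (hg.mul (isTermFun_const t))).and <|
    (isDiophantine_eq ((isTermFun_const t).mul hh) (hh.mul (isTermFun_const t))).and <|
    (isDiophantine_eq (((hg.mul hg).sub ((hf.mul hg).mul hh)).add (hh.mul hh))
      (isTermFun_const 1)).and <|
    isDiophantine_commDvd t (hf.sub (isTermFun_const 2)) ((hg.sub hh).sub (isTermFun_const 1))

theorem isDiophantine_trace (t : M) (hf : IsTermFun Language.ring f)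
    (hg : IsTermFun Language.ring g) : IsDiophantine Language.ring
      {x | ∃ a : Fin 2 → M, IsCommChebyshevPair t (f x) (a 0) (a 1) ∧
        g x = 2 * a 0 - f x * a 1} :=
  have hw (i : Fin 2) := isTermFun_proj (L := Language.ring) (M := M) (Sum.inr i : α ⊕ Fin 2)
  IsDiophantine.exists_fin <|
    (isDiophantine_isCommChebyshevPair t (hf.reindex _) (hw 0) (hw 1)).and <|
      isDiophantine_eq (hg.reindex _)
        (((isTermFun_const 2).mul (hw 0)).sub ((hf.reindex _).mul (hw 1)))

theorem isDiophantine_isCommFrobeniusImage (t : M) (hf : IsTermFun Language.ring f)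
    (hg : IsTermFun Language.ring g) :
    IsDiophantine Language.ring {x | IsCommFrobeniusImage t (f x) (g x)} :=
  (isDiophantine_trace t hf hg).and <|
    isDiophantine_trace t (hf.add (isTermFun_const 1)) (hg.add (isTermFun_const 1))

end Conditions

/-! ### The centralizer of a generator -/

section FreeAlgebra

open Polynomial

variable (K : Type*) [Field K] {X : Type*} (x₀ : X)

/-- The embedding of the polynomial ring in one variable that sends the variable to a
generator of the free algebra. -/
noncomputable def polyHom : K[X] →ₐ[K] FreeAlgebra K X :=
  aeval (FreeAlgebra.ι K x₀)

@[simp]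
theorem polyHom_X : polyHom K x₀ Polynomial.X = FreeAlgebra.ι K x₀ :=
  aeval_X _

@[simp]
theorem polyHom_two : polyHom K x₀ 2 = 2 :=
  map_ofNat (polyHom K x₀) 2

theorem polyHom_injective : Function.Injective (polyHom K x₀) := by
  have h : (FreeAlgebra.lift K (fun _ : X => (Polynomial.X : K[X]))).comp (polyHom K x₀) =
      AlgHom.id K _ := by
    ext
    simp
  exact Function.LeftInverse.injective (g := FreeAlgebra.lift K fun _ : X => (Polynomial.X : K[X]))
    fun q => DFunLike.congr_fun h q

variable {K x₀}

/-- Commutation equates the coefficients of `a w x₀ʲ` and `w x₀ʲ⁺¹` if `a = x₀`, and kills the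
former otherwise. Letters of a word in the support thus move from front to back one by one, each
being `x₀`. -/
theorem coeff_ne_zero_of_commute_single {f : MonoidAlgebra K (FreeMonoid X)}
    (hf : MonoidAlgebra.single (FreeMonoid.of x₀) 1 * f =
      f * MonoidAlgebra.single (FreeMonoid.of x₀) 1) (w : FreeMonoid X) (hw : f.coeff w ≠ 0) :
    ∃ n : ℕ, w = FreeMonoid.of x₀ ^ n := by
  suffices h : ∀ (w : FreeMonoid X) (j : ℕ), f.coeff (w * FreeMonoid.of x₀ ^ j) ≠ 0 →
      ∃ n : ℕ, w = FreeMonoid.of x₀ ^ n from h w 0 (by simpa using hw)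
  intro w
  induction w using FreeMonoid.inductionOn' with
  | one => exact fun _ _ => ⟨0, rfl⟩
  | of_mul a w ih =>
    intro j hj
    have h1 := congrArg (fun g => g.coeff (FreeMonoid.of a * w * FreeMonoid.of x₀ ^ (j + 1))) hf
    beta_reduce at h1
    rw [MonoidAlgebra.coeff_mul_single_eq_coeff_mul (FreeMonoid.of a * w * FreeMonoid.of x₀ ^ j)
      (fun m _ => by rw [pow_succ, ← mul_assoc, mul_left_inj]), mul_one] at h1
    have hax : a = x₀ := by
      by_contra hne
      rw [MonoidAlgebra.coeff_single_mul_of_forall_mul_ne] at h1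
      · exact hj h1.symm
      · intro d hd
        rw [mul_assoc] at hd
        have := congrArg FreeMonoid.toList hd
        simp only [FreeMonoid.toList_of_mul, List.cons.injEq] at this
        exact hne this.1.symm
    subst hax
    rw [MonoidAlgebra.coeff_single_mul_eq_mul_coeff (w * FreeMonoid.of a ^ (j + 1))
      (fun m _ => by rw [mul_assoc, mul_right_inj]), one_mul] at h1
    obtain ⟨n, rfl⟩ := ih (j + 1) (h1 ▸ hj)
    exact ⟨n + 1, (pow_succ' _ _).symm⟩

theorem exists_polyHom_eq_of_commute {a : FreeAlgebra K X}
    (ha : FreeAlgebra.ι K x₀ * a = a * FreeAlgebra.ι K x₀) : ∃ q, polyHom K x₀ q = a := by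
  let e := FreeAlgebra.equivMonoidAlgebraFreeMonoid (R := K) (X := X)
  have he : e (FreeAlgebra.ι K x₀) = MonoidAlgebra.single (FreeMonoid.of x₀) 1 := by
    simp [e, FreeAlgebra.equivMonoidAlgebraFreeMonoid]
  have hf : MonoidAlgebra.single (FreeMonoid.of x₀) 1 * e a =
      e a * MonoidAlgebra.single (FreeMonoid.of x₀) 1 := by
    rw [← he, ← map_mul, ha, map_mul]
  suffices h : e a ∈ ((e : FreeAlgebra K X →ₐ[K] _).comp (polyHom K x₀)).range by
    obtain ⟨q, hq⟩ := h
    exact ⟨q, e.injective hq⟩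
  rw [← MonoidAlgebra.sum_coeff_single (e a)]
  refine Subalgebra.sum_mem _ fun w hw => ?_
  obtain ⟨n, rfl⟩ := coeff_ne_zero_of_commute_single hf w (Finsupp.mem_support_iff.1 hw)
  refine ⟨Polynomial.C ((e a).coeff (FreeMonoid.of x₀ ^ n)) * Polynomial.X ^ n, ?_⟩
  simp [← Polynomial.smul_eq_C_mul, he, MonoidAlgebra.single_pow]

theorem commute_polyHom (q : K[X]) :
    FreeAlgebra.ι K x₀ * polyHom K x₀ q = polyHom K x₀ q * FreeAlgebra.ι K x₀ := by
  rw [← polyHom_X, ← map_mul, ← map_mul, mul_comm]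

theorem commDvd_polyHom_iff (a b : K[X]) :
    CommDvd (FreeAlgebra.ι K x₀) (polyHom K x₀ a) (polyHom K x₀ b) ↔ a ∣ b := by
  constructor
  · rintro ⟨w, hw, h⟩
    obtain ⟨q, rfl⟩ := exists_polyHom_eq_of_commute hw
    exact ⟨q, polyHom_injective K x₀ (by rw [h, map_mul])⟩
  · rintro ⟨q, rfl⟩
    exact ⟨polyHom K x₀ q, commute_polyHom q, map_mul _ _ _⟩

theorem isCommChebyshevPair_polyHom_iff (v : K[X]) (a b : FreeAlgebra K X) :
    IsCommChebyshevPair (FreeAlgebra.ι K x₀) (polyHom K x₀ v) a b ↔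
      ∃ x y, IsChebyshevPair v x y ∧ a = polyHom K x₀ x ∧ b = polyHom K x₀ y := by
  have key (x y : K[X]) : IsCommChebyshevPair (FreeAlgebra.ι K x₀) (polyHom K x₀ v)
      (polyHom K x₀ x) (polyHom K x₀ y) ↔ IsChebyshevPair v x y := by
    rw [IsCommChebyshevPair, IsChebyshevPair, ← commDvd_polyHom_iff (x₀ := x₀),
      ← (polyHom_injective K x₀).eq_iff]
    simp [commute_polyHom]
  constructor
  · rintro h
    obtain ⟨x, rfl⟩ := exists_polyHom_eq_of_commute h.1
    obtain ⟨y, rfl⟩ := exists_polyHom_eq_of_commute h.2.1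
    exact ⟨x, y, (key x y).1 h, rfl, rfl⟩
  · rintro ⟨x, y, h, rfl, rfl⟩
    exact (key x y).2 h

theorem trace_polyHom_iff (v z : K[X]) :
    (∃ a : Fin 2 → FreeAlgebra K X,
      IsCommChebyshevPair (FreeAlgebra.ι K x₀) (polyHom K x₀ v) (a 0) (a 1) ∧
        polyHom K x₀ z = 2 * a 0 - polyHom K x₀ v * a 1) ↔
      ∃ x y, IsChebyshevPair v x y ∧ z = 2 * x - v * y := by
  have key (x y : K[X]) : polyHom K x₀ z = 2 * polyHom K x₀ x - polyHom K x₀ v * polyHom K x₀ y ↔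
      z = 2 * x - v * y := by
    rw [← (polyHom_injective K x₀).eq_iff]
    simp
  constructor
  · rintro ⟨a, ha, hz⟩
    obtain ⟨x, y, h, hx, hy⟩ := (isCommChebyshevPair_polyHom_iff _ _ _).1 ha
    rw [hx, hy, key] at hz
    exact ⟨x, y, h, hz⟩
  · rintro ⟨x, y, h, hz⟩
    exact ⟨![polyHom K x₀ x, polyHom K x₀ y],
      (isCommChebyshevPair_polyHom_iff _ _ _).2 ⟨x, y, h, rfl, rfl⟩, (key x y).2 hz⟩

theorem isCommFrobeniusImage_polyHom_iff (v z : K[X]) :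
    IsCommFrobeniusImage (FreeAlgebra.ι K x₀) (polyHom K x₀ v) (polyHom K x₀ z) ↔
      IsFrobeniusImage v z := by
  have h := trace_polyHom_iff (x₀ := x₀) (v + 1) (z + 1)
  simp only [map_add, map_one] at h
  rw [IsCommFrobeniusImage, IsFrobeniusImage, trace_polyHom_iff, h]

/-! ### Codes of integers and the two interpretations -/

variable (K x₀) in
/-- The pair of elements of the free algebra that represents an integer. -/
noncomputable def intCode (n : ℤ) : Fin 2 → FreeAlgebra K X :=
  ![polyHom K x₀ (Chebyshev.S K n), polyHom K x₀ (Chebyshev.S K (n - 1))]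

theorem intCode_zero (n : ℤ) : intCode K x₀ n 0 = polyHom K x₀ (Chebyshev.S K n) :=
  rfl

theorem intCode_one (n : ℤ) : intCode K x₀ n 1 = polyHom K x₀ (Chebyshev.S K (n - 1)) :=
  rfl

theorem intCode_injective : Function.Injective (intCode K x₀) := fun _ _ h =>
  S_injective (polyHom_injective K x₀ (congrFun h 0)) (polyHom_injective K x₀ (congrFun h 1))

theorem isCommChebyshevPair_generator_iff (a b : FreeAlgebra K X) :
    IsCommChebyshevPair (FreeAlgebra.ι K x₀) (FreeAlgebra.ι K x₀) a b ↔
      ∃ n : ℤ, a = intCode K x₀ n 0 ∧ b = intCode K x₀ n 1 := by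
  have h := isCommChebyshevPair_polyHom_iff (x₀ := x₀) (Polynomial.X : K[X]) a b
  rw [polyHom_X] at h
  simp only [h, isChebyshevPair_iff (v := (Polynomial.X : K[X])) (by simp), comp_X]
  constructor
  · rintro ⟨_, _, ⟨n, rfl, rfl⟩, rfl, rfl⟩
    exact ⟨n, rfl, rfl⟩
  · rintro ⟨n, rfl, rfl⟩
    exact ⟨_, _, ⟨n, rfl, rfl⟩, rfl, rfl⟩

variable (K x₀) in
theorem isDiophantine_range_intCode :
    IsDiophantine FirstOrder.Language.ring (Set.range (intCode K x₀)) := by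
  convert isDiophantine_isCommChebyshevPair (FreeAlgebra.ι K x₀)
    (isTermFun_const (FreeAlgebra.ι K x₀)) (isTermFun_proj (0 : Fin 2)) (isTermFun_proj 1) using 1
  ext a
  refine Iff.trans ?_ (isCommChebyshevPair_generator_iff (a 0) (a 1)).symm
  refine exists_congr fun n => ⟨?_, fun ⟨h0, h1⟩ => ?_⟩
  · rintro rfl
    exact ⟨rfl, rfl⟩
  · ext i
    fin_cases i
    · exact h0.symm
    · exact h1.symm

theorem commDvd_generator_sub_two_iff (q : K[X]) :
    CommDvd (FreeAlgebra.ι K x₀) (FreeAlgebra.ι K x₀ - 2) (polyHom K x₀ q) ↔ q.eval 2 = 0 := by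
  rw [← IsRoot.def, ← dvd_iff_isRoot, C_ofNat, ← commDvd_polyHom_iff (x₀ := x₀)]
  simp

variable (K X) in
theorem eInterpretable_int_of_charZero [CharZero K] [Nonempty X] :
    EInterpretable FirstOrder.Language.ring ℤ FirstOrder.Language.ring (FreeAlgebra K X) := by
  obtain ⟨x₀⟩ := ‹Nonempty X›
  let t := FreeAlgebra.ι K x₀
  have hv {k : ℕ} (i : Fin k) := isTermFun_proj (L := FirstOrder.Language.ring)
    (M := FreeAlgebra K X) (i, (1 : Fin 2))
  refine eInterpretable_of_injective (intCode K x₀) intCode_injective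
    (isDiophantine_range_intCode K x₀) (fun k f => ?_) (fun k r => r.elim)
  -- Every operation becomes the vanishing at `t = 2` of an expression in the second coordinates,
  -- whose values there are the coded integers; characteristic 0 makes `ℤ → K` injective.
  have key {k : ℕ} (g : (Fin k × Fin 2 → FreeAlgebra K X) → FreeAlgebra K X)
      (hg : IsTermFun FirstOrder.Language.ring g) :
      IsDiophantine FirstOrder.Language.ring {v | CommDvd t (t - 2) (g v)} :=
    isDiophantine_commDvd t (isTermFun_const _) hg
  cases f with
  | add =>
    refine ⟨_, key _ (((hv 0).add (hv 1)).sub (hv 2)), fun a => ?_⟩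
    change CommDvd _ _ (intCode K x₀ (a 0) 1 + intCode K x₀ (a 1) 1 - intCode K x₀ (a 2) 1) ↔
      a 0 + a 1 = a 2
    simp only [intCode_one, ← map_add, ← map_sub, t]
    rw [commDvd_generator_sub_two_iff, eval_sub, sub_eq_zero]
    simp
    norm_cast
  | mul =>
    refine ⟨_, key _ (((hv 0).mul (hv 1)).sub (hv 2)), fun a => ?_⟩
    change CommDvd _ _ (intCode K x₀ (a 0) 1 * intCode K x₀ (a 1) 1 - intCode K x₀ (a 2) 1) ↔
      a 0 * a 1 = a 2
    simp only [intCode_one, ← map_mul, ← map_sub, t]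
    rw [commDvd_generator_sub_two_iff, eval_sub, sub_eq_zero]
    simp
    norm_cast
  | neg =>
    refine ⟨_, key _ ((hv 0).neg.sub (hv 1)), fun a => ?_⟩
    change CommDvd _ _ (-intCode K x₀ (a 0) 1 - intCode K x₀ (a 1) 1) ↔ -a 0 = a 1
    simp only [intCode_one, ← map_neg, ← map_sub, t]
    rw [commDvd_generator_sub_two_iff, eval_sub, sub_eq_zero]
    simp
    norm_cast
  | zero =>
    refine ⟨_, key _ (hv 0), fun a => ?_⟩
    change CommDvd _ _ (intCode K x₀ (a 0) 1) ↔ 0 = a 0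
    simp only [intCode_one, t]
    rw [commDvd_generator_sub_two_iff, eq_comm]
    simp
    norm_cast
  | one =>
    refine ⟨_, key _ ((hv 0).sub (isTermFun_const 1)), fun a => ?_⟩
    change CommDvd _ _ (intCode K x₀ (a 0) 1 - 1) ↔ 1 = a 0
    rw [← map_one (polyHom K x₀)]
    simp only [intCode_one, ← map_sub, t]
    rw [commDvd_generator_sub_two_iff, eval_sub, sub_eq_zero, eq_comm]
    simp
    norm_cast

-- These are the two coordinates of `uⁿuᵐ`; the factor `t Sₙ₋₁ - Sₙ` is `Sₙ₋₂`, written in terms of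
-- the code of `n`.
variable (K x₀) in
theorem intCode_add_iff (n m l : ℤ) :
    (intCode K x₀ l 0 = intCode K x₀ n 0 * intCode K x₀ m 0 - intCode K x₀ n 1 * intCode K x₀ m 1 ∧
      intCode K x₀ l 1 = intCode K x₀ n 1 * intCode K x₀ m 0 -
        (FreeAlgebra.ι K x₀ * intCode K x₀ n 1 - intCode K x₀ n 0) * intCode K x₀ m 1) ↔
      n + m = l := by
  have h1 := chebyshev_S_add K n m
  have h2 : Chebyshev.S K (n + m - 1) = Chebyshev.S K (n - 1) * Chebyshev.S K m -
      (Polynomial.X * Chebyshev.S K (n - 1) - Chebyshev.S K n) * Chebyshev.S K (m - 1) := by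
    have h3 := Chebyshev.S_sub_two K n
    rw [show n + m - 1 = n - 1 + m by ring, chebyshev_S_add, sub_sub, one_add_one_eq_two, h3]
  simp only [intCode_zero, intCode_one, ← polyHom_X, ← map_mul, ← map_sub, ← h1, ← h2,
    (polyHom_injective K x₀).eq_iff]
  exact ⟨fun h => (S_injective h.1 h.2).symm, by rintro rfl; exact ⟨rfl, rfl⟩⟩

variable (K x₀) in
theorem intCode_locDvd_iff (p : ℕ) [Fact p.Prime] [CharP K p] (n m : ℤ) :
    (∃ a : Fin 2 → FreeAlgebra K X,
      IsCommChebyshevPair (FreeAlgebra.ι K x₀) (FreeAlgebra.ι K x₀) (a 0) (a 1) ∧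
      IsCommFrobeniusImage (FreeAlgebra.ι K x₀)
        (2 * intCode K x₀ m 0 - FreeAlgebra.ι K x₀ * intCode K x₀ m 1)
        (2 * a 0 - FreeAlgebra.ι K x₀ * a 1) ∧
      CommDvd (FreeAlgebra.ι K x₀) (intCode K x₀ n 1) (a 1)) ↔ LocDvd p n m := by
  have htr (k : ℤ) : 2 * intCode K x₀ k 0 - FreeAlgebra.ι K x₀ * intCode K x₀ k 1 =
      polyHom K x₀ (Chebyshev.C K k) := by
    rw [Chebyshev.C_eq_S_sub_X_mul_S]
    simp [intCode_zero, intCode_one]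
  have key (k : ℤ) : IsCommFrobeniusImage (FreeAlgebra.ι K x₀)
        (2 * intCode K x₀ m 0 - FreeAlgebra.ι K x₀ * intCode K x₀ m 1)
        (2 * intCode K x₀ k 0 - FreeAlgebra.ι K x₀ * intCode K x₀ k 1) ∧
      CommDvd (FreeAlgebra.ι K x₀) (intCode K x₀ n 1) (intCode K x₀ k 1) ↔
      IsFrobeniusImage (Chebyshev.C K m) (Chebyshev.C K k) ∧
      Chebyshev.S K (n - 1) ∣ Chebyshev.S K (k - 1) := by
    rw [htr, htr, isCommFrobeniusImage_polyHom_iff, intCode_one, intCode_one, commDvd_polyHom_iff]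
  rw [locDvd_iff_exists_isFrobeniusImage p (K := K)]
  constructor
  · rintro ⟨a, ha, h⟩
    obtain ⟨k, h0, h1⟩ := (isCommChebyshevPair_generator_iff _ _).1 ha
    rw [h0, h1, key] at h
    exact ⟨k, h⟩
  · rintro ⟨k, h⟩
    exact ⟨intCode K x₀ k, (isCommChebyshevPair_generator_iff _ _).2 ⟨k, rfl, rfl⟩, (key k).2 h⟩

variable (K X) in
theorem eInterpretable_int_addLocDvd (p : ℕ) [Fact p.Prime] [CharP K p] [Nonempty X] :
    EInterpretable (addLocDvd p) ℤ FirstOrder.Language.ring (FreeAlgebra K X) := by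
  obtain ⟨x₀⟩ := ‹Nonempty X›
  let t := FreeAlgebra.ι K x₀
  have hv {k : ℕ} (i : Fin k) (j : Fin 2) := isTermFun_proj (L := FirstOrder.Language.ring)
    (M := FreeAlgebra K X) (i, j)
  refine eInterpretable_of_injective (intCode K x₀) intCode_injective
    (isDiophantine_range_intCode K x₀) (fun k f => ?_) (fun k r => ?_)
  · cases f with
    | add =>
      refine ⟨_, (isDiophantine_eq (hv 2 0)
        (((hv 0 0).mul (hv 1 0)).sub ((hv 0 1).mul (hv 1 1)))).and
        (isDiophantine_eq (hv 2 1) (((hv 0 1).mul (hv 1 0)).sub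
          ((((isTermFun_const t).mul (hv 0 1)).sub (hv 0 0)).mul (hv 1 1)))), fun a => ?_⟩
      exact intCode_add_iff K x₀ (a 0) (a 1) (a 2)
  · cases r with
    | locDvd =>
      have hw (i : Fin 2) := isTermFun_proj (L := FirstOrder.Language.ring)
        (M := FreeAlgebra K X) (Sum.inr i : (Fin 2 × Fin 2) ⊕ Fin 2)
      have hu (i j : Fin 2) := isTermFun_proj (L := FirstOrder.Language.ring)
        (M := FreeAlgebra K X) (Sum.inl (i, j) : (Fin 2 × Fin 2) ⊕ Fin 2)
      have ht := isTermFun_const (L := FirstOrder.Language.ring)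
        (α := (Fin 2 × Fin 2) ⊕ Fin 2) t
      have h2 := isTermFun_const (L := FirstOrder.Language.ring)
        (α := (Fin 2 × Fin 2) ⊕ Fin 2) (2 : FreeAlgebra K X)
      -- The witness `a` codes an integer `±pˢm` divisible by `n`, where `m` is the second argument.
      refine ⟨{v | ∃ a : Fin 2 → FreeAlgebra K X, IsCommChebyshevPair t t (a 0) (a 1) ∧
        IsCommFrobeniusImage t (2 * v (1, 0) - t * v (1, 1)) (2 * a 0 - t * a 1) ∧
        CommDvd t (v (0, 1)) (a 1)}, ?_, fun a => intCode_locDvd_iff K x₀ p (a 0) (a 1)⟩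
      exact IsDiophantine.exists_fin <|
        (isDiophantine_isCommChebyshevPair t ht (hw 0) (hw 1)).and <|
        (isDiophantine_isCommFrobeniusImage t ((h2.mul (hu 1 0)).sub (ht.mul (hu 1 1)))
          ((h2.mul (hw 0)).sub (ht.mul (hw 1)))).and <|
        isDiophantine_commDvd t (hu 0 1) (hw 1)

end FreeAlgebra

end EInterp

theorem mainTheorem2 (K : Type*) [Field K] (X : Type*) [Nonempty X] :
    (CharZero K →
      EInterp.EInterpretable FirstOrder.Language.ring ℤ FirstOrder.Language.ring (FreeAlgebra K X)) ∧
    (∀ p : ℕ, 0 < p → CharP K p →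
      EInterp.EInterpretable (EInterp.addLocDvd p) ℤ FirstOrder.Language.ring (FreeAlgebra K X)) := by
  refine ⟨fun _ => EInterp.eInterpretable_int_of_charZero K X, fun p hp _ => ?_⟩
  have : Fact p.Prime := ⟨(CharP.char_is_prime_or_zero K p).resolve_right hp.ne'⟩
  exact EInterp.eInterpretable_int_addLocDvd K X p
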